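/- Let $(\Omega,\Sigma,\mu)$ be a $\sigma$-finite, purely nonatomic measure space with $\mu(\Omega)>0$, and let $L^0$ be the space of ($\mu$-a.e. classes of) real measurable functions on $\Omega$. A Young function is a convex, non-decreasing function $\varphi:[0,\infty)\to[0,\infty]$ with $\varphi(0)=0$ and $\varphi\not\equiv 0$ (the case $\varphi(u)=\infty$ for all $u>0$ is allowed). Its Orlicz space is $$L^\varphi=\Big\{x\in L^0:\ \int_\Omega\varphi(\lambda|x|)\,d\mu<\infty\ \text{for some }\lambda>0\Big\},$$ and its right-continuous inverse is $\varphi^{-1}(v)=\inf\{u\ge 0:\varphi(u)>v\}$, $v\ge 0$ (with $\inf\emptyset=\infty$ and $0\cdot\infty=0$; the same formula defines $\psi^{-1}$ for any non-decreasing $\psi:[0,\infty)\to[0,\infty]$). For Young functions $\varphi,\varphi_1$ put $$(\varphi\ominus\varphi_1)(u)=\sup\{\varphi(su)-\varphi_1(s):\ s\ge 0,\ \varphi_1(s)<\infty\},\qquad u\ge 0,$$ and for $X,Y\subset L^0$ put $M(X,Y)=\{y\in L^0: xy\in Y\text{ for all }x\in X\}$ and $X\odot M(X,Y)=\{xy: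 x\in X,\ y\in M(X,Y)\}$. **Theorem.** Let $\varphi,\varphi_1$ be Young functions. Then $L^{\varphi_1}$ factorizes $L^{\varphi}$, that is, $$L^{\varphi_1}\odot M(L^{\varphi_1},L^{\varphi})=L^{\varphi}\quad\text{(as sets)},$$ if and only if the equivalence $\varphi_1^{-1}(\varphi\ominus\varphi_1)^{-1}\approx\varphi^{-1}$ holds for all arguments when $\mu(\Omega)=\infty$, respectively for large arguments when $\mu(\Omega)<\infty$; i.e. there are constants $c,C>0$ such that $$c\,\varphi^{-1}(u)\le \varphi_1^{-1}(u)\,(\varphi\ominus\varphi_1)^{-1}(u)\le C\,\varphi^{-1}(u)$$ for all $u\ge 0$ if $\mu(\Omega)=\infty$, respectively for some $u_0>0$ and all $u>u_0$ if $\mu(\Omega)<\infty$. -/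

import Mathlib

open MeasureTheory
open scoped NNReal ENNReal

namespace OrliczFactorization

/-- Young functions `φ : [0, ∞) → [0, ∞]`: convex, non-decreasing, `φ 0 = 0` and `φ ≢ 0`.
The values may jump to `∞`, and `φ u = ∞` for all `u > 0` is allowed. -/
structure IsYoung (φ : ℝ≥0 → ℝ≥0∞) : Prop where
  convexOn : ConvexOn ℝ≥0 Set.univ φ
  monotone : Monotone φ
  map_zero : φ 0 = 0
  ne_zero : ∃ u, φ u ≠ 0

/-- The conjugate `φ ⊖ φ₁` of `φ₁` with respect to `φ`,
`(φ ⊖ φ₁)(u) = sup {φ (s u) - φ₁ s : s ≥ 0, φ₁ s < ∞}`.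
The subtraction of `ℝ≥0∞` cuts off at `0`; this does not change the supremum, because `s = 0`
contributes `φ 0 - φ₁ 0 = 0`. -/
noncomputable def conj (φ φ₁ : ℝ≥0 → ℝ≥0∞) (u : ℝ≥0) : ℝ≥0∞ :=
  ⨆ (s : ℝ≥0) (_ : φ₁ s < ∞), (φ (s * u) - φ₁ s)

/-- The right-continuous inverse `φ⁻¹(v) = inf {u ≥ 0 : φ u > v}` (with `inf ∅ = ∞`). -/
noncomputable def rightInv (φ : ℝ≥0 → ℝ≥0∞) (v : ℝ≥0) : ℝ≥0∞ :=
  ⨅ (u : ℝ≥0) (_ : (v : ℝ≥0∞) < φ u), (u : ℝ≥0∞)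

/-- `φ₁⁻¹ φ₂⁻¹ ≈ φ⁻¹` for all arguments. -/
def EquivAll (φ₁ φ₂ φ : ℝ≥0 → ℝ≥0∞) : Prop :=
  ∃ c C : ℝ≥0, 0 < c ∧ 0 < C ∧ ∀ u : ℝ≥0,
    c * rightInv φ u ≤ rightInv φ₁ u * rightInv φ₂ u ∧
      rightInv φ₁ u * rightInv φ₂ u ≤ C * rightInv φ u

/-- `φ₁⁻¹ φ₂⁻¹ ≈ φ⁻¹` for large arguments. -/
def EquivLarge (φ₁ φ₂ φ : ℝ≥0 → ℝ≥0∞) : Prop :=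
  ∃ c C u₀ : ℝ≥0, 0 < c ∧ 0 < C ∧ 0 < u₀ ∧ ∀ u : ℝ≥0, u₀ < u →
    c * rightInv φ u ≤ rightInv φ₁ u * rightInv φ₂ u ∧
      rightInv φ₁ u * rightInv φ₂ u ≤ C * rightInv φ u

section Spaces

variable {Ω : Type*} [MeasurableSpace Ω]

/-- `μ` is purely nonatomic: each measurable set of positive measure contains a measurable
subset of positive and strictly smaller measure. (Mathlib's `NoAtoms` only says that points are
null.) -/
def Nonatomic (μ : Measure Ω) : Prop :=
  ∀ A, MeasurableSet A → 0 < μ A → ∃ B, B ⊆ A ∧ MeasurableSet B ∧ 0 < μ B ∧ μ B < μ A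

/-- The modular `I_φ(x) = ∫ φ(|x|) dμ`. -/
noncomputable def modular (φ : ℝ≥0 → ℝ≥0∞) {μ : Measure Ω} (x : Ω →ₘ[μ] ℝ) : ℝ≥0∞ :=
  ∫⁻ ω, φ ‖x ω‖₊ ∂μ

/-- The Orlicz space `L^φ` (as a set of classes of functions). -/
def orlicz (φ : ℝ≥0 → ℝ≥0∞) (μ : Measure Ω) : Set (Ω →ₘ[μ] ℝ) :=
  {x | ∃ l : ℝ, 0 < l ∧ modular φ (l • x) < ∞}

/-- The pointwise multipliers `M(X, Y)`. -/
def multipliers {μ : Measure Ω} (X Y : Set (Ω →ₘ[μ] ℝ)) : Set (Ω →ₘ[μ] ℝ) :=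
  {y | ∀ x ∈ X, x * y ∈ Y}

/-- The pointwise product `X ⊙ Z` of two function spaces. -/
def pointwiseProduct {μ : Measure Ω} (X Z : Set (Ω →ₘ[μ] ℝ)) : Set (Ω →ₘ[μ] ℝ) :=
  {z | ∃ x ∈ X, ∃ y ∈ Z, z = x * y}

/-- `X` factorizes `Y`: `X ⊙ M(X, Y) = Y`. -/
def Factorizes {μ : Measure Ω} (X Y : Set (Ω →ₘ[μ] ℝ)) : Prop :=
  pointwiseProduct X (multipliers X Y) = Y

end Spaces

end OrliczFactorization

/-!
Write `φ₂ = φ ⊖ φ₁`. The generalized Young inequality `φ (s u) ≤ φ₁ s + φ₂ u` gives the upper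
estimate `φ₁⁻¹ φ₂⁻¹ ≤ 2 φ⁻¹` unconditionally, and it shows `L^φ₂ ⊆ M(L^φ₁, L^φ)`. The inclusion
`L^φ₁ ⊙ M(L^φ₁, L^φ) ⊆ L^φ` is the definition of `M`, so everything is about the lower estimate
`c φ⁻¹ ≤ φ₁⁻¹ φ₂⁻¹` and the inclusion `L^φ ⊆ L^φ₁ ⊙ M(L^φ₁, L^φ)`.

Given the lower estimate, `z ∈ L^φ` is factored explicitly: for `V = φ (l |z|)`, increased to a
constant when `μ` is finite, put `x = φ₁⁻¹(V) / 2` and `y = z / x`; both modulars are then at most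
`∫ V` (`IsYoung.orlicz_subset_pointwiseProduct`).

For the converse the main point is `M(L^φ₁, L^φ) ⊆ L^φ₂`
(`IsYoung.multipliers_subset_orlicz_conj`). If `∫ φ₂ (λ |y|) = ∞` for all `λ > 0`, near-optimal
choices in the supremum defining `φ₂`, cut down to prescribed modular by Sierpiński's theorem on
nonatomic measures, give `x k` with `I_φ₁(x k) ≤ 2⁻ᵏ` and `I_φ(2⁻ᵏ |x k y|) ≥ 1`. Their supremum
lies in `L^φ₁`, and its product with `y` is not in `L^φ`. Now suppose that the lower estimate fails
at arguments `u n` with constants `8⁻ⁿ`. The supremum `z` of the functions `(φ⁻¹(u n) / 2) χ_{A n}`,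
where `μ (A n) = 2⁻ⁿ / u n`, lies in `L^φ`. If `z = x y` with `x ∈ L^φ₁` and `y ∈ L^φ₂`,
Chebyshev's inequality yields a point of `A n` at which `φ₁ (r |x|)` and `φ₂ (r |y|)` are both at
most `K 2ⁿ u n`. There `r² |x y| ≤ K² 4ⁿ φ₁⁻¹(u n) φ₂⁻¹(u n) ≤ K² 2⁻ⁿ φ⁻¹(u n)`, which is
impossible for large `n` (`IsYoung.exists_lower_estimate`).

Young functions need not be left continuous at the point where they jump to `∞`. For this reason
the suprema and inverses above are halved before `φ` or `φ₁` is applied to them.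
-/

namespace OrliczFactorization

variable {Ω : Type*} [MeasurableSpace Ω] {μ ν : Measure Ω}
  {φ φ₁ : ℝ≥0 → ℝ≥0∞} {u v w s T : ℝ≥0}

/-! ### Young functions and star-shapedness -/

/-- Monotone functions vanishing at `0` for which `u ↦ φ u / u` is non-decreasing. The arguments
about Orlicz spaces and inverses below use no more of convexity than this. -/
structure IsStarShaped (φ : ℝ≥0 → ℝ≥0∞) : Prop where
  monotone : Monotone φ
  map_zero : φ 0 = 0
  mul_le : ∀ T u : ℝ≥0, 1 ≤ T → T * φ u ≤ φ (T * u)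

theorem IsYoung.isStarShaped (hφ : IsYoung φ) : IsStarShaped φ where
  monotone := hφ.monotone
  map_zero := hφ.map_zero
  mul_le T u hT := by
    have hT0 : T ≠ 0 := (zero_lt_one.trans_le hT).ne'
    have h := hφ.convexOn.2 (Set.mem_univ (T * u)) (Set.mem_univ 0) (zero_le (a := T⁻¹))
      (zero_le (a := 1 - T⁻¹)) (add_tsub_cancel_of_le (inv_le_one_of_one_le₀ hT))
    rw [hφ.map_zero, smul_zero, smul_zero, add_zero, add_zero, smul_eq_mul,
      inv_mul_cancel_left₀ hT0, ENNReal.smul_def, smul_eq_mul] at h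
    calc (T : ℝ≥0∞) * φ u ≤ T * ((T⁻¹ : ℝ≥0) * φ (T * u)) := by gcongr
      _ = φ (T * u) := by
        rw [← mul_assoc, ← ENNReal.coe_mul, mul_inv_cancel₀ hT0, ENNReal.coe_one, one_mul]

theorem IsYoung.exists_lt (hφ : IsYoung φ) (v : ℝ≥0) : ∃ u, (v : ℝ≥0∞) < φ u := by
  obtain ⟨u, hu⟩ := hφ.ne_zero
  obtain ⟨n, hn⟩ := ENNReal.exists_nat_mul_gt hu (b := v) ENNReal.coe_ne_top
  refine ⟨(n + 1 : ℝ≥0) * u, hn.trans_le ?_⟩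
  refine le_trans ?_ (hφ.isStarShaped.mul_le (n + 1) u (by simp))
  gcongr
  push_cast
  exact le_self_add

theorem IsStarShaped.two_mul_apply_half (hφ : IsStarShaped φ) (u : ℝ≥0) :
    2 * φ (u / 2) ≤ φ u := by
  have := hφ.mul_le 2 (u / 2) (by norm_num)
  rwa [mul_div_cancel₀ u two_ne_zero, ENNReal.coe_ofNat] at this

/-! ### Right-continuous inverses -/

theorem le_rightInv (hφ : Monotone φ) (h : φ u ≤ v) : (u : ℝ≥0∞) ≤ rightInv φ v :=
  le_iInf₂ fun _ hw ↦ ENNReal.coe_le_coe.2 (hφ.reflect_lt (h.trans_lt hw)).le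

theorem le_of_lt_rightInv (h : (u : ℝ≥0∞) < rightInv φ v) : φ u ≤ v :=
  not_lt.1 fun hu ↦ h.not_ge (iInf₂_le u hu)

theorem monotone_rightInv (φ : ℝ≥0 → ℝ≥0∞) : Monotone (rightInv φ) := fun _ _ h ↦
  le_iInf₂ fun u hu ↦ iInf₂_le u ((ENNReal.coe_le_coe.2 h).trans_lt hu)

theorem IsYoung.rightInv_lt_top (hφ : IsYoung φ) (v : ℝ≥0) : rightInv φ v < ∞ := by
  obtain ⟨u, hu⟩ := hφ.exists_lt v
  exact (iInf₂_le u hu).trans_lt ENNReal.coe_lt_top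

theorem IsStarShaped.rightInv_mul_le (hφ : IsStarShaped φ) (hT : 1 ≤ T) (v : ℝ≥0) :
    rightInv φ (T * v) ≤ T * rightInv φ v := by
  have hT0 : (T : ℝ≥0∞) ≠ 0 := by
    exact_mod_cast (zero_lt_one.trans_le hT).ne'
  rw [rightInv, rightInv, ENNReal.mul_iInf_of_ne hT0 ENNReal.coe_ne_top]
  refine le_iInf fun u ↦ ?_
  rw [ENNReal.mul_iInf_of_ne hT0 ENNReal.coe_ne_top]
  refine le_iInf fun hu ↦ ?_
  rw [← ENNReal.coe_mul]
  have hlt : ((T * v : ℝ≥0) : ℝ≥0∞) < T * φ u := by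
    rw [ENNReal.coe_mul]
    exact (ENNReal.mul_lt_mul_iff_right hT0 ENNReal.coe_ne_top).2 hu
  exact iInf₂_le (T * u) (hlt.trans_le (hφ.mul_le T u hT))

/-- Halving compensates for the possible lack of left continuity of `φ` where it jumps to `∞`. -/
theorem IsYoung.apply_half_rightInv_le (hφ : IsYoung φ) (v : ℝ≥0) :
    φ ((rightInv φ v).toNNReal / 2) ≤ v := by
  obtain h | h := eq_or_ne (rightInv φ v) 0
  · simp [h, hφ.map_zero]
  · refine le_of_lt_rightInv ?_
    lift rightInv φ v to ℝ≥0 using (hφ.rightInv_lt_top v).ne with r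
    rw [ENNReal.toNNReal_coe, ENNReal.coe_lt_coe]
    exact half_lt_self (pos_iff_ne_zero.2 (by simpa using h))

theorem exists_rightInv_lt (φ : ℝ≥0 → ℝ≥0∞) {r : ℝ≥0∞} (h : rightInv φ 0 < r) :
    ∃ v, 0 < v ∧ rightInv φ v < r := by
  simp only [rightInv, iInf_lt_iff] at h
  obtain ⟨u, hu, hur⟩ := h
  obtain ⟨v, hv0, hv⟩ := ENNReal.lt_iff_exists_nnreal_btwn.1 hu
  exact ⟨v, by exact_mod_cast hv0, (iInf₂_le u hv).trans_lt hur⟩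

/-! ### The conjugate function and the generalized Young inequality -/

theorem young_inequality (φ φ₁ : ℝ≥0 → ℝ≥0∞) (s u : ℝ≥0) :
    φ (s * u) ≤ φ₁ s + conj φ φ₁ u := by
  obtain h | h := eq_or_ne (φ₁ s) ∞
  · simp [h]
  · rw [← tsub_le_iff_left]
    exact le_iSup₂ (f := fun (s : ℝ≥0) (_ : φ₁ s < ∞) ↦ φ (s * u) - φ₁ s) s h.lt_top

theorem IsYoung.isStarShaped_conj (hφ : IsYoung φ) (φ₁ : ℝ≥0 → ℝ≥0∞) :
    IsStarShaped (conj φ φ₁) where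
  monotone u v h := iSup₂_mono fun s _ ↦ tsub_le_tsub_right (hφ.monotone (by gcongr)) _
  map_zero := by simp [conj, hφ.map_zero]
  mul_le T u hT := by
    simp only [conj, ENNReal.mul_iSup]
    refine iSup₂_mono fun s hs ↦ ?_
    rw [ENNReal.mul_sub (by simp), mul_left_comm s T u]
    refine tsub_le_tsub (hφ.isStarShaped.mul_le _ _ hT) ?_
    exact le_mul_of_one_le_left (zero_le) (by exact_mod_cast hT)

/-- `(φ ⊖ φ₁)⁻¹` takes the value `∞` only in the degenerate case `φ₁⁻¹ = 0`. -/
theorem IsYoung.rightInv_eq_zero_of_conj (hφ : IsYoung φ) (h : rightInv (conj φ φ₁) v = ∞)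
    (w : ℝ≥0) : rightInv φ₁ w = 0 := by
  by_contra hw
  obtain ⟨s, hs0, hs⟩ := ENNReal.lt_iff_exists_nnreal_btwn.1 (pos_iff_ne_zero.2 hw)
  have hs0 : s ≠ 0 := by rintro rfl; simp at hs0
  have hsw := le_of_lt_rightInv hs
  obtain ⟨u, hu⟩ := hφ.exists_lt (v + w)
  refine ENNReal.coe_ne_top (r := u / s) (top_le_iff.1 (h ▸ iInf₂_le (u / s) ?_))
  have hy := young_inequality φ φ₁ s (u / s)
  rw [mul_div_cancel₀ u hs0] at hy
  by_contra hc
  have := hy.trans (add_le_add hsw (not_lt.1 hc))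
  rw [add_comm, ← ENNReal.coe_add] at this
  exact hu.not_ge this

/-- The upper estimate in `φ₁⁻¹ (φ ⊖ φ₁)⁻¹ ≈ φ⁻¹` holds always. -/
theorem IsYoung.rightInv_mul_rightInv_conj_le (hφ : IsYoung φ) (φ₁ : ℝ≥0 → ℝ≥0∞) (v : ℝ≥0) :
    rightInv φ₁ v * rightInv (conj φ φ₁) v ≤ 2 * rightInv φ v := by
  refine ENNReal.mul_le_of_forall_lt fun a ha b hb ↦ ?_
  lift a to ℝ≥0 using ha.ne_top
  lift b to ℝ≥0 using hb.ne_top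
  have hy : φ (a * b) ≤ 2 * v := by
    rw [two_mul]
    exact (young_inequality φ φ₁ a b).trans
      (add_le_add (le_of_lt_rightInv ha) (le_of_lt_rightInv hb))
  have h2 : φ (a * b / 2) ≤ v :=
    (ENNReal.mul_le_mul_iff_right two_ne_zero ENNReal.ofNat_ne_top).1
      ((hφ.isStarShaped.two_mul_apply_half _).trans hy)
  calc (a : ℝ≥0∞) * b = 2 * ((a * b / 2 : ℝ≥0) : ℝ≥0∞) := by
        rw [← ENNReal.coe_ofNat, ← ENNReal.coe_mul, ← ENNReal.coe_mul,
          mul_div_cancel₀ _ two_ne_zero]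
    _ ≤ 2 * rightInv φ v := by gcongr; exact le_rightInv hφ.monotone h2

/-- A lower estimate at all positive arguments extends to `0`, by right continuity. -/
theorem IsYoung.lower_estimate_zero (hφ : IsYoung φ) (hφ₁ : IsYoung φ₁) {c : ℝ≥0∞}
    (h : ∀ v : ℝ≥0, 0 < v →
      c * rightInv φ v ≤ rightInv φ₁ v * rightInv (conj φ φ₁) v) :
    c * rightInv φ 0 ≤ rightInv φ₁ 0 * rightInv (conj φ φ₁) 0 := by
  by_cases hd : rightInv (conj φ φ₁) 0 = ∞
  · calc c * rightInv φ 0 ≤ c * rightInv φ 1 := by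
          gcongr; exact monotone_rightInv φ zero_le_one
      _ ≤ rightInv φ₁ 1 * rightInv (conj φ φ₁) 1 := h 1 one_pos
      _ ≤ _ := by simp [hφ.rightInv_eq_zero_of_conj hd]
  · refine ENNReal.le_mul_of_forall_lt (.inr hd) (.inl (hφ₁.rightInv_lt_top 0).ne)
      fun a ha b hb ↦ ?_
    obtain ⟨v, hv, hva⟩ := exists_rightInv_lt φ₁ ha
    obtain ⟨w, hw, hwb⟩ := exists_rightInv_lt _ hb
    have hm : 0 < min v w := lt_min hv hw
    calc c * rightInv φ 0 ≤ c * rightInv φ (min v w) := by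
          gcongr; exact monotone_rightInv φ (zero_le)
      _ ≤ _ := h _ hm
      _ ≤ a * b := by
          gcongr
          · exact (monotone_rightInv _ (min_le_left _ _)).trans hva.le
          · exact (monotone_rightInv _ (min_le_right _ _)).trans hwb.le

/-! ### Nonatomic measures -/

theorem Nonatomic.exists_subset_measure_le [SigmaFinite ν] (hν : Nonatomic ν) {E : Set Ω}
    (hE : MeasurableSet E) (hE0 : 0 < ν E) {ε : ℝ≥0∞} (hε : ε ≠ 0) :
    ∃ B ⊆ E, MeasurableSet B ∧ 0 < ν B ∧ ν B ≤ ε := by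
  obtain ⟨F, hF, hFE, hF0, hFtop⟩ := Measure.exists_subset_measure_lt_top hE hE0
  have key : ∀ n : ℕ, ∃ B ⊆ F, MeasurableSet B ∧ 0 < ν B ∧ 2 ^ n * ν B ≤ ν F := by
    intro n
    induction n with
    | zero => exact ⟨F, subset_rfl, hF, hF0, by simp⟩
    | succ n ih =>
      obtain ⟨B, hBF, hB, hB0, hBn⟩ := ih
      obtain ⟨C, hCB, hC, hC0, hClt⟩ := hν B hB hB0
      have hsum : ν C + ν (B \ C) = ν B := by
        rw [← measure_inter_add_sdiff B hC, Set.inter_eq_self_of_subset_right hCB]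
      have hD0 : 0 < ν (B \ C) := by
        refine pos_iff_ne_zero.2 fun h ↦ ?_
        rw [h, add_zero] at hsum
        exact hClt.ne hsum
      have aux : ∀ x y : ℝ≥0∞, x + y = ν B → x ≤ y → 2 ^ (n + 1) * x ≤ ν F := by
        intro x y hxy hle
        calc 2 ^ (n + 1) * x = 2 ^ n * (x + x) := by ring
          _ ≤ 2 ^ n * ν B := by rw [← hxy]; gcongr
          _ ≤ ν F := hBn
      rcases le_total (ν C) (ν (B \ C)) with h | h
      · exact ⟨C, hCB.trans hBF, hC, hC0, aux _ _ hsum h⟩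
      · exact ⟨B \ C, Set.sdiff_subset.trans hBF, hB.diff hC, hD0,
          aux _ _ (by rw [add_comm, hsum]) h⟩
  obtain ⟨n, hn⟩ := ENNReal.exists_nat_mul_gt hε hFtop.ne
  obtain ⟨B, hBF, hB, hB0, hBn⟩ := key n
  refine ⟨B, hBF.trans hFE, hB, hB0, ?_⟩
  by_contra hlt
  have h2 : (n : ℝ≥0∞) ≤ 2 ^ n := by exact_mod_cast n.lt_two_pow_self.le
  exact absurd (calc n * ε ≤ 2 ^ n * ν B := by gcongr; exact (not_le.1 hlt).le
    _ ≤ ν F := hBn) hn.not_ge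

theorem exists_measure_le_add {P : Set (Set Ω)} (hP : P.Nonempty) {a : ℝ≥0∞} (ha : a ≠ ∞)
    (hPa : ∀ T ∈ P, ν T ≤ a) {ε : ℝ≥0∞} (hε : ε ≠ 0) :
    ∃ T ∈ P, ∀ T' ∈ P, ν T' ≤ ν T + ε := by
  set M := sSup (ν '' P)
  have hle : ∀ T' ∈ P, ν T' ≤ M := fun T' h ↦ le_sSup (Set.mem_image_of_mem _ h)
  have hM : M ≠ ∞ := ne_top_of_le_ne_top ha (sSup_le (by rintro _ ⟨T, hT, rfl⟩; exact hPa T hT))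
  obtain hM0 | hM0 := eq_or_ne M 0
  · obtain ⟨T, hT⟩ := hP
    exact ⟨T, hT, fun T' h ↦ (hle T' h).trans (by simp [hM0])⟩
  · obtain ⟨_, ⟨T, hT, rfl⟩, hlt⟩ := lt_sSup_iff.1 (ENNReal.sub_lt_self hM hM0 hε)
    exact ⟨T, hT, fun T' h ↦ (hle T' h).trans (tsub_le_iff_right.1 hlt.le)⟩

/-- Sierpiński's theorem: a nonatomic σ-finite measure takes all intermediate values. The set is
exhausted greedily: each step is almost optimal among the admissible enlargements, so the union
admits no further enlargement. -/
theorem Nonatomic.exists_subset_measure_eq [SigmaFinite ν] (hν : Nonatomic ν) {E : Set Ω}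
    (hE : MeasurableSet E) {a : ℝ≥0∞} (ha : a ≠ ∞) (haE : a ≤ ν E) :
    ∃ B ⊆ E, MeasurableSet B ∧ ν B = a := by
  let P : Set (Set Ω) := {T | MeasurableSet T ∧ T ⊆ E ∧ ν T ≤ a}
  have step : ∀ (n : ℕ) (S : P), ∃ T : P, S.1 ⊆ T.1 ∧
      ∀ T' ∈ P, S.1 ⊆ T' → ν T' ≤ ν T.1 + (n + 1 : ℝ≥0∞)⁻¹ := by
    intro n S
    obtain ⟨T, hT, hmax⟩ := exists_measure_le_add (ν := ν) (P := {T | T ∈ P ∧ S.1 ⊆ T})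
      ⟨S.1, S.2, subset_rfl⟩ ha (fun T hT ↦ hT.1.2.2) (ε := (n + 1 : ℝ≥0∞)⁻¹)
      (ENNReal.inv_ne_zero.2 (by finiteness))
    exact ⟨⟨T, hT.1⟩, hT.2, fun T' h h' ↦ hmax T' ⟨h, h'⟩⟩
  choose next hsub hmax using step
  let S : ℕ → P := fun n ↦ n.rec ⟨∅, .empty, Set.empty_subset _, by simp⟩ next
  have hmono : Monotone fun n ↦ (S n).1 := monotone_nat_of_le_succ fun n ↦ hsub n (S n)
  set U := ⋃ n, (S n).1
  have hU : MeasurableSet U := .iUnion fun n ↦ (S n).2.1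
  have hUE : U ⊆ E := Set.iUnion_subset fun n ↦ (S n).2.2.1
  have hUa : ν U ≤ a := by
    rw [hmono.measure_iUnion]
    exact iSup_le fun n ↦ (S n).2.2.2
  refine ⟨U, hUE, hU, hUa.antisymm (not_lt.1 fun hlt ↦ ?_)⟩
  have hUtop : ν U ≠ ∞ := hlt.ne_top
  have hdiff : 0 < ν (E \ U) := by
    rw [measure_sdiff hUE hU.nullMeasurableSet hUtop]
    exact tsub_pos_of_lt (hlt.trans_le haE)
  obtain ⟨C, hCE, hC, hC0, hCa⟩ := hν.exists_subset_measure_le (hE.diff hU) hdiff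
    (tsub_pos_of_lt hlt).ne'
  have hUC : ν (U ∪ C) = ν U + ν C :=
    measure_union (Set.disjoint_left.2 fun x hx hx' ↦ (hCE hx').2 hx) hC
  have hmem : U ∪ C ∈ P := by
    refine ⟨hU.union hC, Set.union_subset hUE (hCE.trans Set.sdiff_subset), ?_⟩
    rw [hUC]
    calc ν U + ν C ≤ ν U + (a - ν U) := by gcongr
      _ = a := add_tsub_cancel_of_le hUa
  obtain ⟨n, hn⟩ := ENNReal.exists_inv_nat_lt hC0.ne'
  have h1 : ν U + ν C ≤ ν U + (n + 1 : ℝ≥0∞)⁻¹ := by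
    rw [← hUC]
    refine (hmax n (S n) _ hmem
      ((Set.subset_iUnion (fun n ↦ (S n).1) n).trans Set.subset_union_left)).trans ?_
    gcongr
    exact Set.subset_iUnion (fun n ↦ (S n).1) (n + 1)
  have h2 := (ENNReal.add_le_add_iff_left hUtop).1 h1
  exact absurd (h2.trans (ENNReal.inv_le_inv.2 le_self_add)) hn.not_ge

theorem Nonatomic.withDensity (hμ : Nonatomic μ) {f : Ω → ℝ≥0∞} (hf : Measurable f)
    [SigmaFinite (μ.withDensity f)] : Nonatomic (μ.withDensity f) := by
  intro A hA hA0
  obtain ⟨F, hF, hFA, hF0, hFtop⟩ := Measure.exists_subset_measure_lt_top hA hA0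
  have hpos : ∀ s, 0 < μ.withDensity f s ↔ 0 < μ ({x | f x ≠ 0} ∩ s) := fun s ↦ by
    rw [pos_iff_ne_zero, pos_iff_ne_zero, ne_eq, withDensity_apply_eq_zero hf]
  obtain ⟨B, hBF, hB, hB0, hBlt⟩ := hμ ({x | f x ≠ 0} ∩ F)
    ((measurableSet_eq_fun hf measurable_const).compl.inter hF) ((hpos F).1 hF0)
  have hBF' : B ⊆ F := hBF.trans Set.inter_subset_right
  refine ⟨B, hBF'.trans hFA, hB, ?_, lt_of_lt_of_le ?_ (measure_mono hFA)⟩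
  · rw [hpos, Set.inter_eq_self_of_subset_right (hBF.trans Set.inter_subset_left)]
    exact hB0
  · have hdiff : 0 < μ.withDensity f (F \ B) := by
      rw [hpos, ← Set.inter_sdiff_assoc]
      exact (tsub_pos_of_lt hBlt).trans_le le_measure_sdiff
    rw [← measure_inter_add_sdiff F hB, Set.inter_eq_self_of_subset_right hBF']
    exact ENNReal.lt_add_right (ne_top_of_le_ne_top hFtop.ne (measure_mono hBF')) hdiff.ne'

/-! ### Orlicz spaces -/

theorem mem_orlicz_iff {x : Ω →ₘ[μ] ℝ} :
    x ∈ orlicz φ μ ↔ ∃ l : ℝ≥0, 0 < l ∧ ∫⁻ ω, φ (l * ‖x ω‖₊) ∂μ < ∞ := by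
  have h : ∀ l : ℝ≥0, modular φ ((l : ℝ) • x) = ∫⁻ ω, φ (l * ‖x ω‖₊) ∂μ := fun l ↦ by
    refine lintegral_congr_ae ?_
    filter_upwards [AEEqFun.coeFn_smul (l : ℝ) x] with ω hω
    rw [hω, Pi.smul_apply, smul_eq_mul, nnnorm_mul, NNReal.nnnorm_eq]
  constructor
  · rintro ⟨l, hl, hx⟩
    lift l to ℝ≥0 using hl.le
    exact ⟨l, by exact_mod_cast hl, by rwa [← h]⟩
  · rintro ⟨l, hl, hx⟩
    exact ⟨l, by exact_mod_cast hl, by rwa [h]⟩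

theorem mk_mem_orlicz_iff {f : Ω → ℝ} (hf : AEStronglyMeasurable f μ) :
    AEEqFun.mk f hf ∈ orlicz φ μ ↔ ∃ l : ℝ≥0, 0 < l ∧ ∫⁻ ω, φ (l * ‖f ω‖₊) ∂μ < ∞ := by
  have h : ∀ l : ℝ≥0, ∫⁻ ω, φ (l * ‖AEEqFun.mk f hf ω‖₊) ∂μ = ∫⁻ ω, φ (l * ‖f ω‖₊) ∂μ :=
    fun l ↦ lintegral_congr_ae <| by
      filter_upwards [AEEqFun.coeFn_mk f hf] with ω hω
      rw [hω]
  simp only [mem_orlicz_iff, h]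

/-- By the generalized Young inequality, elements of `L^(φ ⊖ φ₁)` multiply `L^φ₁` into `L^φ`. -/
theorem IsYoung.orlicz_conj_subset_multipliers (hφ₁ : IsYoung φ₁) :
    orlicz (conj φ φ₁) μ ⊆ multipliers (orlicz φ₁ μ) (orlicz φ μ) := by
  intro y hy x hx
  obtain ⟨l, hl, hy⟩ := mem_orlicz_iff.1 hy
  obtain ⟨m, hm, hx⟩ := mem_orlicz_iff.1 hx
  refine mem_orlicz_iff.2 ⟨m * l, by positivity, ?_⟩
  have hmeas : AEMeasurable (fun ω ↦ φ₁ (m * ‖x ω‖₊)) μ :=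
    (hφ₁.monotone.measurable.comp
      ((measurable_const_mul m).comp (AEEqFun.measurable x).nnnorm)).aemeasurable
  calc ∫⁻ ω, φ (m * l * ‖(x * y) ω‖₊) ∂μ
      ≤ ∫⁻ ω, (φ₁ (m * ‖x ω‖₊) + conj φ φ₁ (l * ‖y ω‖₊)) ∂μ := by
        refine lintegral_mono_ae ?_
        filter_upwards [AEEqFun.coeFn_mul x y] with ω hω
        rw [hω, Pi.mul_apply, nnnorm_mul, mul_mul_mul_comm]
        exact young_inequality φ φ₁ _ _
    _ < ∞ := by
        rw [lintegral_add_left' hmeas]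
        exact ENNReal.add_lt_top.2 ⟨hx, hy⟩

/-- Countably many functions with summable modulars have a common majorant in `L^φ`. -/
theorem IsYoung.exists_majorant (hφ : IsYoung φ) {z : ℕ → Ω → ℝ≥0}
    (hz : ∀ k, Measurable (z k)) (hsum : ∑' k, ∫⁻ ω, φ (z k ω) ∂μ ≠ ∞) :
    ∃ Z : Ω → ℝ≥0, Measurable Z ∧ (∀ᵐ ω ∂μ, ∀ k, z k ω ≤ Z ω) ∧
      ∫⁻ ω, φ (Z ω / 2) ∂μ < ∞ := by
  have hm : ∀ k, Measurable fun ω ↦ φ (z k ω) := fun k ↦ hφ.monotone.measurable.comp (hz k)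
  rw [← lintegral_tsum fun k ↦ (hm k).aemeasurable] at hsum
  have hfin := ae_lt_top (Measurable.tsum hm) hsum
  set W : Ω → ℝ≥0∞ := fun ω ↦ ⨆ k, (z k ω : ℝ≥0∞)
  have hW : ∀ᵐ ω ∂μ, W ω ≠ ∞ := by
    filter_upwards [hfin] with ω hω
    obtain ⟨u, hu⟩ := hφ.exists_lt (∑' k, φ (z k ω)).toNNReal
    rw [ENNReal.coe_toNNReal hω.ne] at hu
    refine ne_top_of_le_ne_top (ENNReal.coe_ne_top (r := u)) (iSup_le fun k ↦ ?_)
    exact ENNReal.coe_le_coe.2 (hφ.monotone.reflect_lt ((ENNReal.le_tsum k).trans_lt hu)).le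
  refine ⟨fun ω ↦ (W ω).toNNReal,
    (Measurable.iSup fun k ↦ (hz k).coe_nnreal_ennreal).ennreal_toNNReal, ?_, ?_⟩
  · filter_upwards [hW] with ω hω k
    rw [← ENNReal.coe_le_coe, ENNReal.coe_toNNReal hω]
    exact le_iSup (fun k ↦ (z k ω : ℝ≥0∞)) k
  · refine (lintegral_mono_ae ?_).trans_lt hsum.lt_top
    filter_upwards [hW] with ω hω
    obtain h0 | h0 := eq_or_ne (W ω).toNNReal 0
    · simp [h0, hφ.map_zero]
    · have hlt : (((W ω).toNNReal / 2 : ℝ≥0) : ℝ≥0∞) < W ω := by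
        conv_rhs => rw [← ENNReal.coe_toNNReal hω]
        exact ENNReal.coe_lt_coe.2 (half_lt_self (pos_iff_ne_zero.2 h0))
      obtain ⟨k, hk⟩ := lt_iSup_iff.1 hlt
      exact (hφ.monotone (ENNReal.coe_lt_coe.1 hk).le).trans
        (ENNReal.le_tsum (f := fun k ↦ φ (z k ω)) k)

/-! ### Multipliers lie in the Orlicz space of the conjugate function -/

/-- The supremum defining `φ ⊖ φ₁` may be taken over a dense sequence, at the price of a
factor `2` in the argument of `φ`. -/
theorem IsYoung.conj_le_iSup_denseSeq (hφ : IsYoung φ) (hφ₁ : IsYoung φ₁) (u : ℝ≥0) :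
    conj φ φ₁ u ≤ ⨆ i : ℕ,
      if φ₁ (TopologicalSpace.denseSeq ℝ≥0 i) < ∞ then
        φ (TopologicalSpace.denseSeq ℝ≥0 i * (2 * u)) - φ₁ (TopologicalSpace.denseSeq ℝ≥0 i)
      else 0 := by
  refine iSup₂_le fun s hs ↦ ?_
  obtain rfl | hs0 := eq_or_ne s 0
  · simp [hφ.map_zero]
  obtain ⟨_, ⟨i, rfl⟩, h1, h2⟩ := (TopologicalSpace.denseRange_denseSeq ℝ≥0).exists_between
    (half_lt_self (pos_iff_ne_zero.2 hs0))
  refine le_iSup_of_le i ?_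
  have hle := hφ₁.monotone h2.le
  rw [if_pos (hle.trans_lt hs)]
  refine tsub_le_tsub (hφ.monotone ?_) hle
  calc s * u = s / 2 * (2 * u) := by rw [← mul_assoc, div_mul_cancel₀ _ two_ne_zero]
    _ ≤ _ := by gcongr

/-- Nearly optimal measurable choice of `s` in the supremum defining `(φ ⊖ φ₁)(Y ω)`. -/
theorem IsYoung.exists_selection (hφ : IsYoung φ) (hφ₁ : IsYoung φ₁) {Y : Ω → ℝ≥0}
    (hY : Measurable Y) {c : ℝ≥0∞} (hc : c < ∫⁻ ω, conj φ φ₁ (Y ω) ∂μ) :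
    ∃ s : Ω → ℝ≥0, Measurable s ∧ (∀ ω, φ₁ (s ω) < ∞) ∧
      (∀ ω, φ₁ (s ω) ≤ φ (s ω * (2 * Y ω))) ∧ c ≤ ∫⁻ ω, φ (s ω * (2 * Y ω)) ∂μ := by
  let q := TopologicalSpace.denseSeq ℝ≥0
  let G : ℕ → Ω → ℝ≥0∞ := fun i ω ↦
    if φ₁ (q i) < ∞ then φ (q i * (2 * Y ω)) - φ₁ (q i) else 0
  have hφm : ∀ {g : Ω → ℝ≥0}, Measurable g → Measurable fun ω ↦ φ (g ω * (2 * Y ω)) :=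
    fun hg ↦ hφ.monotone.measurable.comp (hg.mul (hY.const_mul 2))
  have hG : ∀ i, Measurable (G i) := fun i ↦ by
    by_cases h : φ₁ (q i) < ∞
    · simp only [G, if_pos h]
      exact (hφm measurable_const).sub_const _
    · simp only [G, if_neg h]
      exact measurable_const
  have hFm : ∀ n, Measurable fun ω ↦ ⨆ i < n, G i ω := fun n ↦
    .iSup fun i ↦ .iSup fun _ ↦ hG i
  have hlim : ∫⁻ ω, conj φ φ₁ (Y ω) ∂μ ≤ ⨆ n : ℕ, ∫⁻ ω, ⨆ i < n, G i ω ∂μ := by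
    rw [← lintegral_iSup hFm fun m n h ω ↦ biSup_mono fun i hi ↦ hi.trans_le h]
    refine lintegral_mono fun ω ↦ (hφ.conj_le_iSup_denseSeq hφ₁ _).trans (iSup_le fun i ↦ ?_)
    exact le_iSup_of_le (i + 1) (le_iSup₂_of_le i i.lt_succ_self le_rfl)
  obtain ⟨n, hn⟩ := lt_iSup_iff.1 (hc.trans_le hlim)
  -- `s` is a running maximizer: it switches to `q n` where `G n` beats the previous choice.
  have sel : ∀ n : ℕ, ∃ s : Ω → ℝ≥0, Measurable s ∧ (∀ ω, φ₁ (s ω) < ∞) ∧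
      (∀ ω, φ₁ (s ω) ≤ φ (s ω * (2 * Y ω))) ∧
      ∀ ω, ∀ i < n, G i ω ≤ φ (s ω * (2 * Y ω)) - φ₁ (s ω) := by
    intro n
    induction n with
    | zero => exact ⟨0, measurable_const, by simp [hφ₁.map_zero], by simp [hφ₁.map_zero], by simp⟩
    | succ n ih =>
      obtain ⟨s, hs, hfin, hle, hGs⟩ := ih
      have hA : MeasurableSet {ω | φ (s ω * (2 * Y ω)) - φ₁ (s ω) < G n ω} :=
        measurableSet_lt ((hφm hs).sub (hφ₁.monotone.measurable.comp hs)) (hG n)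
      classical
      refine ⟨fun ω ↦ if φ (s ω * (2 * Y ω)) - φ₁ (s ω) < G n ω then q n else s ω,
        Measurable.ite hA measurable_const hs, ?_⟩
      simp only [← forall_and]
      intro ω
      split_ifs with h
      · have hfin' : φ₁ (q n) < ∞ := by
          by_contra hc
          simp [G, if_neg hc] at h
        have hGn : G n ω = φ (q n * (2 * Y ω)) - φ₁ (q n) := if_pos hfin'
        refine ⟨hfin', (tsub_pos_iff_lt.1 (hGn ▸ (zero_le).trans_lt h)).le, fun i hi ↦ ?_⟩
        rw [← hGn]
        obtain hi | rfl := Nat.lt_succ_iff_lt_or_eq.1 hi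
        · exact (hGs ω i hi).trans h.le
        · exact le_rfl
      · refine ⟨hfin ω, hle ω, fun i hi ↦ ?_⟩
        obtain hi | rfl := Nat.lt_succ_iff_lt_or_eq.1 hi
        · exact hGs ω i hi
        · exact not_lt.1 h
  obtain ⟨s, hs, hfin, hle, hGs⟩ := sel n
  exact ⟨s, hs, hfin, hle, hn.le.trans (lintegral_mono fun ω ↦
    iSup₂_le fun i hi ↦ (hGs ω i hi).trans tsub_le_self)⟩

/-- If `(φ ⊖ φ₁)(Y)` is not integrable, there are functions with modular `I_φ₁ ≤ a` whose product
with `2 Y` has modular `I_φ ≥ a`. Nonatomicity allows to cut `x` down to the required size. -/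
theorem IsYoung.exists_test_function [SigmaFinite μ] (hna : Nonatomic μ) (hφ : IsYoung φ)
    (hφ₁ : IsYoung φ₁) {Y : Ω → ℝ≥0} (hY : Measurable Y)
    (h : ∫⁻ ω, conj φ φ₁ (Y ω) ∂μ = ∞) {a : ℝ≥0∞} (ha : a ≠ ∞) :
    ∃ x : Ω → ℝ≥0, Measurable x ∧ ∫⁻ ω, φ₁ (x ω) ∂μ ≤ a ∧
      a ≤ ∫⁻ ω, φ (x ω * (2 * Y ω)) ∂μ := by
  obtain ⟨s, hs, hfin, hle, hint⟩ := hφ.exists_selection hφ₁ hY (h ▸ ha.lt_top)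
  have hf : Measurable fun ω ↦ φ₁ (s ω) := hφ₁.monotone.measurable.comp hs
  obtain hsa | hsa := le_total (∫⁻ ω, φ₁ (s ω) ∂μ) a
  · exact ⟨s, hs, hsa, hint⟩
  have : SigmaFinite (μ.withDensity fun ω ↦ φ₁ (s ω)) :=
    SigmaFinite.withDensity_of_ne_top (.of_forall fun ω ↦ (hfin ω).ne)
  obtain ⟨B, -, hB, hBa⟩ := (hna.withDensity hf).exists_subset_measure_eq MeasurableSet.univ ha
    (by rwa [withDensity_apply _ .univ, setLIntegral_univ])
  rw [withDensity_apply _ hB] at hBa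
  have hind : ∀ (ψ : ℝ≥0 → ℝ≥0∞) (Z : Ω → ℝ≥0), ψ 0 = 0 →
      ∫⁻ ω, ψ (B.indicator s ω * Z ω) ∂μ = ∫⁻ ω in B, ψ (s ω * Z ω) ∂μ := fun ψ Z h0 ↦ by
    rw [← lintegral_indicator hB]
    congr 1 with ω
    by_cases hω : ω ∈ B <;> simp [hω, h0]
  refine ⟨B.indicator s, hs.indicator hB, ?_, ?_⟩
  · have := hind φ₁ 1 hφ₁.map_zero
    simp only [Pi.one_apply, mul_one] at this
    rw [this, hBa]
  · rw [hind φ _ hφ.map_zero, ← hBa]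
    exact lintegral_mono hle

/-- The pointwise multipliers from `L^φ₁` to `L^φ` belong to `L^(φ ⊖ φ₁)`. Otherwise test
functions `x k` with `I_φ₁(x k) ≤ 2⁻ᵏ` and `I_φ(2⁻ᵏ |x k y|) ≥ 1` exist, and their common
majorant violates the multiplier property. -/
theorem IsYoung.multipliers_subset_orlicz_conj [SigmaFinite μ] (hna : Nonatomic μ)
    (hφ : IsYoung φ) (hφ₁ : IsYoung φ₁) :
    multipliers (orlicz φ₁ μ) (orlicz φ μ) ⊆ orlicz (conj φ φ₁) μ := by
  intro y hy
  by_contra hcon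
  have hdiv : ∀ l : ℝ≥0, 0 < l → ∫⁻ ω, conj φ φ₁ (l * ‖y ω‖₊) ∂μ = ∞ := fun l hl ↦ by
    by_contra h
    exact hcon (mem_orlicz_iff.2 ⟨l, hl, lt_top_iff_ne_top.2 h⟩)
  have hYm : Measurable fun ω ↦ ‖y ω‖₊ := (AEEqFun.measurable y).nnnorm
  have htest : ∀ k : ℕ, ∃ x : Ω → ℝ≥0, Measurable x ∧ ∫⁻ ω, φ₁ (x ω) ∂μ ≤ 2⁻¹ ^ k ∧
      1 ≤ ∫⁻ ω, φ (2⁻¹ ^ k * (x ω * ‖y ω‖₊)) ∂μ := by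
    intro k
    -- One factor `2⁻ᵏ` raises the lower bound from `2⁻ᵏ` to `1`, the other one stays in front
    -- of `x y`.
    obtain ⟨x, hx, hx1, hx2⟩ := hφ.exists_test_function hna hφ₁
      (Y := fun ω ↦ 2⁻¹ * (2⁻¹ ^ k * 2⁻¹ ^ k) * ‖y ω‖₊) (hYm.const_mul _)
      (hdiv _ (by positivity)) (a := 2⁻¹ ^ k) (by finiteness)
    refine ⟨x, hx, hx1, ?_⟩
    have h2 : (2 : ℝ≥0) ^ k * 2⁻¹ ^ k = 1 := by rw [← mul_pow]; simp
    have h2' : (2 : ℝ≥0∞) ^ k * 2⁻¹ ^ k = 1 := by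
      rw [← mul_pow, ENNReal.mul_inv_cancel two_ne_zero ENNReal.ofNat_ne_top, one_pow]
    calc (1 : ℝ≥0∞) = 2 ^ k * 2⁻¹ ^ k := h2'.symm
      _ ≤ 2 ^ k * ∫⁻ ω, φ (x ω * (2 * (2⁻¹ * (2⁻¹ ^ k * 2⁻¹ ^ k) * ‖y ω‖₊))) ∂μ := by gcongr
      _ = ∫⁻ ω, 2 ^ k * φ (x ω * (2 * (2⁻¹ * (2⁻¹ ^ k * 2⁻¹ ^ k) * ‖y ω‖₊))) ∂μ :=
        (lintegral_const_mul' _ _ (by finiteness)).symm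
      _ ≤ ∫⁻ ω, φ (2⁻¹ ^ k * (x ω * ‖y ω‖₊)) ∂μ := by
        refine lintegral_mono fun ω ↦ ?_
        have := hφ.isStarShaped.mul_le (2 ^ k)
          (x ω * (2 * (2⁻¹ * (2⁻¹ ^ k * 2⁻¹ ^ k) * ‖y ω‖₊))) (one_le_pow₀ one_le_two)
        push_cast at this
        refine this.trans_eq (congrArg φ ?_)
        calc _ = (2 * 2⁻¹) * (2 ^ k * 2⁻¹ ^ k) * (2⁻¹ ^ k * (x ω * ‖y ω‖₊)) := by ring
          _ = _ := by rw [h2, mul_inv_cancel₀ two_ne_zero, one_mul, one_mul]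
  choose x hx hx1 hx2 using htest
  obtain ⟨Z, hZ, hxZ, hZint⟩ := hφ₁.exists_majorant (μ := μ) hx <| by
    refine ne_top_of_le_ne_top ?_ (ENNReal.tsum_le_tsum hx1)
    rw [ENNReal.tsum_geometric]
    simp
  have hZmem : AEEqFun.mk (fun ω ↦ (Z ω : ℝ)) hZ.coe_nnreal_real.aestronglyMeasurable ∈
      orlicz φ₁ μ := by
    refine (mk_mem_orlicz_iff _).2 ⟨2⁻¹, by positivity, ?_⟩
    simpa only [NNReal.nnnorm_eq, div_eq_inv_mul] using hZint
  obtain ⟨l, hl, hfin⟩ := mem_orlicz_iff.1 (hy _ hZmem)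
  -- `1 ≤ I_φ(2⁻ᵏ |Z y|)` for large `k` improves to `2ʲ ≤ I_φ(l |Z y|)` for all `j`.
  have hlow : ∀ j : ℕ, (2 : ℝ≥0∞) ^ j ≤ ∫⁻ ω, φ (l * (Z ω * ‖y ω‖₊)) ∂μ := by
    intro j
    obtain ⟨k, hk⟩ := exists_pow_lt_of_lt_one (show 0 < 2⁻¹ ^ j * l by positivity)
      (show (2⁻¹ : ℝ≥0) < 1 by exact inv_lt_one_of_one_lt₀ one_lt_two)
    have hkl : 2 ^ j * 2⁻¹ ^ k ≤ l := by
      calc 2 ^ j * 2⁻¹ ^ k ≤ 2 ^ j * (2⁻¹ ^ j * l) := by gcongr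
        _ = l := by rw [← mul_assoc, ← mul_pow, mul_inv_cancel₀ two_ne_zero, one_pow, one_mul]
    calc (2 : ℝ≥0∞) ^ j ≤ 2 ^ j * ∫⁻ ω, φ (2⁻¹ ^ k * (x k ω * ‖y ω‖₊)) ∂μ :=
          le_mul_of_one_le_right (zero_le) (hx2 k)
      _ = ∫⁻ ω, 2 ^ j * φ (2⁻¹ ^ k * (x k ω * ‖y ω‖₊)) ∂μ :=
        (lintegral_const_mul' _ _ (by finiteness)).symm
      _ ≤ _ := by
        refine lintegral_mono_ae ?_
        filter_upwards [hxZ] with ω hω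
        have := hφ.isStarShaped.mul_le (2 ^ j) (2⁻¹ ^ k * (x k ω * ‖y ω‖₊))
          (one_le_pow₀ one_le_two)
        push_cast at this
        refine this.trans (hφ.monotone ?_)
        rw [← mul_assoc]
        gcongr
        exact hω k
  have heq : ∫⁻ ω, φ (l * (Z ω * ‖y ω‖₊)) ∂μ < ∞ := by
    refine lt_of_eq_of_lt (lintegral_congr_ae ?_) hfin
    filter_upwards [AEEqFun.coeFn_mul (AEEqFun.mk (fun ω ↦ (Z ω : ℝ))
      hZ.coe_nnreal_real.aestronglyMeasurable) y, AEEqFun.coeFn_mk (fun ω ↦ (Z ω : ℝ))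
      hZ.coe_nnreal_real.aestronglyMeasurable] with ω h1 h2
    rw [h1, Pi.mul_apply, h2, nnnorm_mul, NNReal.nnnorm_eq]
  obtain ⟨j, hj⟩ := ENNReal.exists_nat_gt heq.ne
  have : (j : ℝ≥0∞) ≤ 2 ^ j := by exact_mod_cast j.lt_two_pow_self.le
  exact absurd (this.trans (hlow j)) hj.not_ge

/-! ### Factorization from the lower estimate -/

theorem measurable_toNNReal_rightInv {V : Ω → ℝ≥0} (hV : Measurable V)
    (φ : ℝ≥0 → ℝ≥0∞) : Measurable fun ω ↦ (rightInv φ (V ω)).toNNReal :=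
  ((monotone_rightInv φ).measurable.comp hV).ennreal_toNNReal

/-- If `c φ⁻¹ ≤ φ₁⁻¹ (φ ⊖ φ₁)⁻¹` on `[b, ∞)`, every `z ∈ L^φ` is a product: with
`V = max (φ (l |z|)) b` one takes `x = φ₁⁻¹(V) / 2` and `y = z / x`. The hypothesis on `b` forces `b = 0` if `μ` is infinite,
since `0 * ∞ = 0`. -/
theorem IsYoung.orlicz_subset_pointwiseProduct (hφ : IsYoung φ) (hφ₁ : IsYoung φ₁)
    {b c : ℝ≥0} (hc : 0 < c) (hb : b * μ Set.univ ≠ ∞)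
    (h : ∀ u, b ≤ u → c * rightInv φ u ≤ rightInv φ₁ u * rightInv (conj φ φ₁) u) :
    orlicz φ μ ⊆ pointwiseProduct (orlicz φ₁ μ) (orlicz (conj φ φ₁) μ) := by
  intro z hz
  obtain ⟨l, hl, hz⟩ := mem_orlicz_iff.1 hz
  have hzm : Measurable z := AEEqFun.measurable z
  have hm : Measurable fun ω ↦ φ (l * ‖z ω‖₊) :=
    hφ.monotone.measurable.comp (hzm.nnnorm.const_mul l)
  set V : Ω → ℝ≥0 := fun ω ↦ (φ (l * ‖z ω‖₊)).toNNReal ⊔ b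
  have hV : Measurable V := hm.ennreal_toNNReal.sup_const b
  have hVint : ∫⁻ ω, V ω ∂μ < ∞ := by
    calc ∫⁻ ω, V ω ∂μ ≤ ∫⁻ ω, (φ (l * ‖z ω‖₊) + b) ∂μ := by
          refine lintegral_mono fun ω ↦ ?_
          rw [ENNReal.coe_max]
          exact max_le (ENNReal.coe_toNNReal_le_self.trans le_self_add) le_add_self
      _ = ∫⁻ ω, φ (l * ‖z ω‖₊) ∂μ + b * μ Set.univ := by
          rw [lintegral_add_left hm, lintegral_const]
      _ < ∞ := ENNReal.add_lt_top.2 ⟨hz, hb.lt_top⟩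
  have hzV : ∀ᵐ ω ∂μ, ((l * ‖z ω‖₊ : ℝ≥0) : ℝ≥0∞) ≤ rightInv φ (V ω) := by
    filter_upwards [ae_lt_top hm hz.ne] with ω hω
    refine le_rightInv hφ.monotone ?_
    rw [ENNReal.coe_max, ENNReal.coe_toNNReal hω.ne]
    exact le_max_left _ _
  set X : Ω → ℝ≥0 := fun ω ↦ (rightInv φ₁ (V ω)).toNNReal / 2
  have hX : Measurable X := (measurable_toNNReal_rightInv hV φ₁).div_const 2
  have hXV : ∀ ω, rightInv φ₁ (V ω) = 2 * X ω := fun ω ↦ by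
    rw [← ENNReal.coe_ofNat, ← ENNReal.coe_mul, mul_div_cancel₀ _ two_ne_zero,
      ENNReal.coe_toNNReal (hφ₁.rightInv_lt_top _).ne]
  have hlow : ∀ᵐ ω ∂μ, ((c * (l * ‖z ω‖₊) : ℝ≥0) : ℝ≥0∞) ≤
      2 * X ω * rightInv (conj φ φ₁) (V ω) := by
    filter_upwards [hzV] with ω hω
    rw [← hXV, ENNReal.coe_mul]
    refine le_trans ?_ (h (V ω) (le_max_right _ _))
    gcongr
  have hXm : AEStronglyMeasurable (fun ω ↦ (X ω : ℝ)) μ := hX.coe_nnreal_real.aestronglyMeasurable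
  have hYm : AEStronglyMeasurable (fun ω ↦ z ω / X ω) μ :=
    (hzm.div hX.coe_nnreal_real).aestronglyMeasurable
  refine ⟨AEEqFun.mk _ hXm, ?_, AEEqFun.mk _ hYm, ?_, ?_⟩
  · refine (mk_mem_orlicz_iff _).2 ⟨1, one_pos, ?_⟩
    refine lt_of_le_of_lt (lintegral_mono fun ω ↦ ?_) hVint
    rw [one_mul, NNReal.nnnorm_eq]
    exact hφ₁.apply_half_rightInv_le (V ω)
  · refine (mk_mem_orlicz_iff _).2 ⟨c * l / 4, by positivity, ?_⟩
    refine lt_of_le_of_lt (lintegral_mono_ae ?_) hVint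
    filter_upwards [hlow] with ω hω
    rw [nnnorm_div, NNReal.nnnorm_eq]
    obtain h0 | h0 := eq_or_ne (‖z ω‖₊ / X ω) 0
    · rw [h0, mul_zero, (hφ.isStarShaped_conj φ₁).map_zero]
      exact zero_le
    have hX0 : X ω ≠ 0 := fun h ↦ h0 (by rw [h, div_zero])
    refine le_of_lt_rightInv (lt_of_lt_of_le (b := ((c * l / 2 * (‖z ω‖₊ / X ω) : ℝ≥0) : ℝ≥0∞))
      (ENNReal.coe_lt_coe.2 ?_) ?_)
    · have := pos_iff_ne_zero.2 h0
      gcongr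
      norm_num
    · have h2X : (2 * X ω : ℝ≥0∞) ≠ 0 := by simp [hX0]
      rw [← ENNReal.mul_le_mul_iff_right h2X (by finiteness)]
      refine le_trans (le_of_eq ?_) hω
      norm_cast
      field_simp
  · refine AEEqFun.ext ?_
    filter_upwards [hlow, AEEqFun.coeFn_mul (AEEqFun.mk _ hXm) (AEEqFun.mk _ hYm),
      AEEqFun.coeFn_mk _ hXm, AEEqFun.coeFn_mk _ hYm] with ω hω h1 h2 h3
    rw [h1, Pi.mul_apply, h2, h3]
    obtain h0 | h0 := eq_or_ne (X ω) 0
    -- Where the divisor `X` vanishes, `z` vanishes too.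
    · rw [h0, ENNReal.coe_zero, mul_zero, zero_mul, nonpos_iff_eq_zero, ENNReal.coe_eq_zero] at hω
      simpa [h0, hc.ne', hl.ne'] using hω
    · rw [mul_div_cancel₀]
      exact_mod_cast h0

theorem pointwiseProduct_multipliers_subset (X Y : Set (Ω →ₘ[μ] ℝ)) :
    pointwiseProduct X (multipliers X Y) ⊆ Y := by
  rintro _ ⟨x, hx, y, hy, rfl⟩
  exact hy x hx

theorem IsYoung.factorizes_of_lower_estimate (hφ : IsYoung φ) (hφ₁ : IsYoung φ₁)
    {b c : ℝ≥0} (hc : 0 < c) (hb : b * μ Set.univ ≠ ∞)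
    (h : ∀ u, b ≤ u → c * rightInv φ u ≤ rightInv φ₁ u * rightInv (conj φ φ₁) u) :
    Factorizes (orlicz φ₁ μ) (orlicz φ μ) := by
  refine (pointwiseProduct_multipliers_subset _ _).antisymm fun z hz ↦ ?_
  obtain ⟨x, hx, y, hy, hxy⟩ := hφ.orlicz_subset_pointwiseProduct hφ₁ hc hb h hz
  exact ⟨x, hx, y, orlicz_conj_subset_multipliers hφ₁ hy, hxy⟩

/-! ### The lower estimate from factorization -/

theorem exists_mem_apply_le {F : Ω → ℝ≥0∞} {A : Set Ω} (hA : MeasurableSet A)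
    {t : ℝ≥0∞} (h : ∫⁻ ω, F ω ∂μ < t * μ A) {p : Ω → Prop} (hp : ∀ᵐ ω ∂μ, p ω) :
    ∃ ω ∈ A, F ω ≤ t ∧ p ω := by
  by_contra! hcon
  refine h.not_ge ?_
  calc t * μ A = ∫⁻ _ in A, t ∂μ := (setLIntegral_const A t).symm
    _ ≤ ∫⁻ ω in A, F ω ∂μ := by
      refine lintegral_mono_ae ((ae_restrict_iff' hA).2 ?_)
      filter_upwards [hp] with ω hω hωA
      by_contra hlt
      exact hcon ω hωA (not_le.1 hlt).le hω
    _ ≤ ∫⁻ ω, F ω ∂μ := setLIntegral_le_lintegral A F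

/-- If the lower estimate failed, with constants `8⁻ⁿ` at arguments `u n`, a function that is at
least `φ⁻¹(u n) / 2` on a set of measure `2⁻ⁿ / u n` for each `n` would belong to `L^φ`, but
Chebyshev's inequality for its two factors would bound it by a multiple of `2⁻ⁿ φ⁻¹(u n)`
somewhere on the `n`-th set. The condition `1 ≤ u μ(Ω)` leaves room for these sets in `Ω`; they
need not be disjoint. -/
theorem IsYoung.exists_lower_estimate [SigmaFinite μ] (hna : Nonatomic μ) (hφ : IsYoung φ)
    (hφ₁ : IsYoung φ₁) (hfac : Factorizes (orlicz φ₁ μ) (orlicz φ μ)) :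
    ∃ c : ℝ≥0, 0 < c ∧ ∀ u : ℝ≥0, 0 < u → 1 ≤ u * μ Set.univ →
      c * rightInv φ u ≤ rightInv φ₁ u * rightInv (conj φ φ₁) u := by
  by_contra! hcon
  choose u hu0 huμ hu using fun n : ℕ ↦ hcon (8⁻¹ ^ n) (by positivity)
  have hA : ∀ n, ∃ A, MeasurableSet A ∧ u n * μ A = 2⁻¹ ^ n := by
    intro n
    have hun : (u n : ℝ≥0∞) ≠ 0 := by exact_mod_cast (hu0 n).ne'
    have hle : 2⁻¹ ^ n / (u n : ℝ≥0∞) ≤ μ Set.univ := by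
      refine ENNReal.div_le_of_le_mul' (le_trans ?_ (huμ n))
      exact pow_le_one₀ (zero_le) (ENNReal.inv_le_one.2 (by norm_num))
    obtain ⟨A, -, hA, hAn⟩ := hna.exists_subset_measure_eq MeasurableSet.univ
      (ENNReal.div_ne_top (by finiteness) hun) hle
    exact ⟨A, hA, by rw [hAn, ENNReal.mul_div_cancel hun ENNReal.coe_ne_top]⟩
  choose A hA hAu using hA
  set a : ℕ → ℝ≥0 := fun n ↦ (rightInv φ (u n)).toNNReal / 2
  have ha : ∀ n, rightInv φ (u n) = 2 * a n := fun n ↦ by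
    rw [← ENNReal.coe_ofNat, ← ENNReal.coe_mul, mul_div_cancel₀ _ two_ne_zero,
      ENNReal.coe_toNNReal (hφ.rightInv_lt_top _).ne]
  have ha0 : ∀ n, a n ≠ 0 := fun n h ↦ by
    have := hu n
    rw [ha n, h] at this
    simp at this
  obtain ⟨Z, hZ, haZ, hZint⟩ := hφ.exists_majorant (μ := μ)
    (z := fun n ↦ (A n).indicator fun _ ↦ a n) (fun n ↦ measurable_const.indicator (hA n)) <| by
      refine ne_top_of_le_ne_top ?_ (ENNReal.tsum_le_tsum (g := fun n ↦ 2⁻¹ ^ n) fun n ↦ ?_)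
      · rw [ENNReal.tsum_geometric]
        simp
      · have : (fun ω ↦ φ ((A n).indicator (fun _ ↦ a n) ω)) =
            (A n).indicator fun _ ↦ φ (a n) := by
          ext ω
          by_cases h : ω ∈ A n <;> simp [h, hφ.map_zero]
        rw [this, lintegral_indicator_const (hA n), ← hAu n]
        gcongr
        exact hφ.apply_half_rightInv_le (u n)
  have hZm : AEStronglyMeasurable (fun ω ↦ (Z ω : ℝ)) μ := hZ.coe_nnreal_real.aestronglyMeasurable
  have hZmem : AEEqFun.mk _ hZm ∈ orlicz φ μ := by
    refine (mk_mem_orlicz_iff _).2 ⟨2⁻¹, by positivity, ?_⟩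
    simpa only [NNReal.nnnorm_eq, div_eq_inv_mul] using hZint
  rw [← hfac] at hZmem
  obtain ⟨x, hx, y, hy, hxy⟩ := hZmem
  obtain ⟨l, hl, hxl⟩ := mem_orlicz_iff.1 hx
  obtain ⟨m, hm, hym⟩ := mem_orlicz_iff.1 (hφ.multipliers_subset_orlicz_conj hna hφ₁ hy)
  set r : ℝ≥0 := min l m
  have hr : 0 < r := lt_min hl hm
  have hZxy : ∀ᵐ ω ∂μ, Z ω = ‖x ω‖₊ * ‖y ω‖₊ := by
    have h1 := AEEqFun.coeFn_mk _ hZm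
    rw [hxy] at h1
    filter_upwards [h1, AEEqFun.coeFn_mul x y] with ω h1 h2
    rw [← nnnorm_mul, ← Pi.mul_apply, ← h2, h1, NNReal.nnnorm_eq]
  set F : Ω → ℝ≥0∞ := fun ω ↦ φ₁ (r * ‖x ω‖₊) + conj φ φ₁ (r * ‖y ω‖₊)
  have hF : ∫⁻ ω, F ω ∂μ < ∞ := by
    have hmeas : Measurable fun ω ↦ φ₁ (r * ‖x ω‖₊) :=
      hφ₁.monotone.measurable.comp ((AEEqFun.measurable x).nnnorm.const_mul r)
    rw [lintegral_add_left hmeas]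
    refine ENNReal.add_lt_top.2 ⟨hxl.trans_le' (lintegral_mono fun ω ↦ hφ₁.monotone ?_),
      hym.trans_le' (lintegral_mono fun ω ↦ (hφ.isStarShaped_conj φ₁).monotone ?_)⟩
    · gcongr
      exact min_le_left _ _
    · gcongr
      exact min_le_right _ _
  set K : ℝ≥0 := (∫⁻ ω, F ω ∂μ).toNNReal + 1
  have hFK : ∫⁻ ω, F ω ∂μ < K := by
    rw [ENNReal.coe_add, ENNReal.coe_toNNReal hF.ne]
    exact ENNReal.lt_add_right hF.ne (by simp)
  have key : ∀ n : ℕ, r * r ≤ 2 * (K * K) * 2⁻¹ ^ n := by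
    intro n
    set T : ℝ≥0 := K * 2 ^ n
    have hT : 1 ≤ T := one_le_mul (le_add_self) (one_le_pow₀ one_le_two)
    have hTA : ∫⁻ ω, F ω ∂μ < (T * u n : ℝ≥0) * μ (A n) := by
      have h2 : (2 : ℝ≥0∞) ^ n * 2⁻¹ ^ n = 1 := by
        rw [← mul_pow, ENNReal.mul_inv_cancel two_ne_zero ENNReal.ofNat_ne_top, one_pow]
      have : ((T * u n : ℝ≥0) : ℝ≥0∞) * μ (A n) = K := by
        rw [ENNReal.coe_mul, mul_assoc, hAu n]
        simp only [T, ENNReal.coe_mul, ENNReal.coe_pow, ENNReal.coe_ofNat]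
        rw [mul_assoc, h2, mul_one]
      rwa [this]
    obtain ⟨ω, hωA, hωF, hωZ, hωxy⟩ := exists_mem_apply_le (hA n) hTA (haZ.and hZxy)
    have haω : a n ≤ ‖x ω‖₊ * ‖y ω‖₊ := by
      rw [← hωxy]
      simpa [hωA] using hωZ n
    have hxω : ((r * ‖x ω‖₊ : ℝ≥0) : ℝ≥0∞) ≤ T * rightInv φ₁ (u n) :=
      (le_rightInv hφ₁.monotone (le_self_add.trans hωF)).trans
        (hφ₁.isStarShaped.rightInv_mul_le hT _)
    have hyω : ((r * ‖y ω‖₊ : ℝ≥0) : ℝ≥0∞) ≤ T * rightInv (conj φ φ₁) (u n) :=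
      (le_rightInv (hφ.isStarShaped_conj φ₁).monotone (le_add_self.trans hωF)).trans
        ((hφ.isStarShaped_conj φ₁).rightInv_mul_le hT _)
    have hmain : ((r * r * a n : ℝ≥0) : ℝ≥0∞) ≤ ((T * T * (8⁻¹ ^ n * (2 * a n)) : ℝ≥0) : ℝ≥0∞) :=
      calc ((r * r * a n : ℝ≥0) : ℝ≥0∞) ≤ ((r * r * (‖x ω‖₊ * ‖y ω‖₊) : ℝ≥0) : ℝ≥0∞) := by
            rw [ENNReal.coe_le_coe]
            gcongr
        _ = ((r * ‖x ω‖₊ : ℝ≥0) : ℝ≥0∞) * ((r * ‖y ω‖₊ : ℝ≥0) : ℝ≥0∞) := by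
            rw [← ENNReal.coe_mul, mul_mul_mul_comm]
        _ ≤ (T * rightInv φ₁ (u n)) * (T * rightInv (conj φ φ₁) (u n)) := by gcongr
        _ = T * T * (rightInv φ₁ (u n) * rightInv (conj φ φ₁) (u n)) := by ring
        _ ≤ T * T * (((8⁻¹ ^ n : ℝ≥0) : ℝ≥0∞) * rightInv φ (u n)) := by
            exact mul_le_mul' le_rfl (hu n).le
        _ = _ := by
            rw [ha n]
            push_cast
            rfl
    have hmain' : r * r * a n ≤ T * T * (8⁻¹ ^ n * 2) * a n := by
      calc r * r * a n ≤ T * T * (8⁻¹ ^ n * (2 * a n)) := ENNReal.coe_le_coe.1 hmain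
        _ = _ := by ring
    refine (le_of_mul_le_mul_right hmain' (pos_iff_ne_zero.2 (ha0 n))).trans_eq ?_
    have h8 : (2 : ℝ≥0) ^ n * 2 ^ n * 8⁻¹ ^ n = 2⁻¹ ^ n := by
      rw [← mul_pow, ← mul_pow]
      congr 1
      rw [← NNReal.coe_inj]
      norm_num
    calc T * T * (8⁻¹ ^ n * 2) = 2 * (K * K) * (2 ^ n * 2 ^ n * 8⁻¹ ^ n) := by ring
      _ = _ := by rw [h8]
  have hK : 0 < K := by positivity
  obtain ⟨n, hn⟩ := exists_pow_lt_of_lt_one (show 0 < r * r / (2 * (K * K)) by positivity)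
    (show (2⁻¹ : ℝ≥0) < 1 from inv_lt_one_of_one_lt₀ one_lt_two)
  rw [lt_div_iff₀ (by positivity), mul_comm] at hn
  exact hn.not_ge (key n)

end OrliczFactorization

theorem theorem2 {Ω : Type*} [MeasurableSpace Ω] (μ : Measure Ω) [SigmaFinite μ]
    (hμ : μ ≠ 0) (hna : OrliczFactorization.Nonatomic μ)
    (φ φ₁ : ℝ≥0 → ℝ≥0∞)
    (hφ : OrliczFactorization.IsYoung φ) (hφ₁ : OrliczFactorization.IsYoung φ₁) :
    OrliczFactorization.Factorizes
        (OrliczFactorization.orlicz φ₁ μ) (OrliczFactorization.orlicz φ μ) ↔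
      ((μ Set.univ = ∞ →
          OrliczFactorization.EquivAll φ₁ (OrliczFactorization.conj φ φ₁) φ) ∧
        (μ Set.univ < ∞ →
          OrliczFactorization.EquivLarge φ₁ (OrliczFactorization.conj φ φ₁) φ)) := by
  have hμ0 : μ Set.univ ≠ 0 := by simpa using hμ
  constructor
  · intro hfac
    obtain ⟨c, hc, h⟩ := hφ.exists_lower_estimate hna hφ₁ hfac
    constructor
    · intro htop
      have hpos : ∀ u : ℝ≥0, 0 < u → c * OrliczFactorization.rightInv φ u ≤
          OrliczFactorization.rightInv φ₁ u *
            OrliczFactorization.rightInv (OrliczFactorization.conj φ φ₁) u := fun u hu ↦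
        h u hu (by simp [htop, ENNReal.mul_top, hu.ne'])
      refine ⟨c, 2, hc, two_pos, fun u ↦ ⟨?_, hφ.rightInv_mul_rightInv_conj_le φ₁ u⟩⟩
      obtain rfl | hu := eq_or_ne u 0
      · exact hφ.lower_estimate_zero hφ₁ hpos
      · exact hpos u (pos_iff_ne_zero.2 hu)
    · intro hfin
      lift μ Set.univ to ℝ≥0 using hfin.ne with M
      have hM : 0 < M := pos_iff_ne_zero.2 (by simpa using hμ0)
      refine ⟨c, 2, M⁻¹, hc, two_pos, inv_pos.2 hM, fun u hu ↦
        ⟨h u ((zero_le).trans_lt hu) ?_, hφ.rightInv_mul_rightInv_conj_le φ₁ u⟩⟩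
      have : 1 ≤ u * M := (inv_le_iff_one_le_mul₀ hM).1 hu.le
      exact_mod_cast this
  · rintro ⟨hall, hlarge⟩
    obtain htop | hfin := eq_or_ne (μ Set.univ) ∞
    · obtain ⟨c, C, hc, -, h⟩ := hall htop
      exact hφ.factorizes_of_lower_estimate hφ₁ (b := 0) hc (by simp) fun u _ ↦ (h u).1
    · obtain ⟨c, C, u₀, hc, -, -, h⟩ := hlarge hfin.lt_top
      exact hφ.factorizes_of_lower_estimate hφ₁ (b := u₀ + 1) hc
        (ENNReal.mul_ne_top ENNReal.coe_ne_top hfin) fun u hu ↦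
          (h u ((lt_add_one u₀).trans_le hu)).1
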